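/- Let $\Omega\subset\mathbb R^2$ be open with coordinates $x,y$ and metric $h=e^{2u}(dx^2+dy^2)$, $u\in C^\infty(\Omega,\mathbb R)$ (that is, $\Omega$ is a domain in a Riemannian surface described in isothermal coordinates), and let $e_1=e^{-u}\partial_x$, $e_2=e^{-u}\partial_y$. In the spin frame over $(e_1,e_2)$ spinors are $\mathbb C^2$-valued functions with the Hermitian product $\langle\cdot,\cdot\rangle$ (conjugate-linear in the first, linear in the second argument); Clifford multiplication by $e_1,e_2$ is given by constant skew-Hermitian endomorphisms with $e_\alpha\cdot e_\beta\cdot+e_\beta\cdot e_\alpha\cdot=-2\delta_{\alpha\beta}$, one has $\partial_x\cdot=e^{u}e_1\cdot$ and $\partial_y\cdot=e^ue_2\cdot$, the spinor connection is $\nabla_{X}\psi=X(\psi)+\tfrac12h(\nabla_Xe_1,e_2)\,e_1\cdot e_2\cdot\psi$, and the Dirac operator is $\slashed\partial=\sum_\alpha e_\alpha\cdot\nabla_{e_\alpha}$. Let $\kappa\in\mathbb R$, and sum over repeated indices. Let $(\phi,\psi)$ be a smooth $\kappa$-Dirac-harmonic map from $\Omega$ to $S^n\subset\mathbb R^{n+1}$: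 $\phi\colon\Omega\to S^n$ is smooth, $\psi=(\psi^1,\dots,\psi^{n+1})$ is a tuple of smooth spinors with $\phi^i\psi^i=0$, and for $i=1,\dots,n+1$, with $\phi^j_\alpha=d\phi^j(e_\alpha)$, $|\psi|^2=\sum_j|\psi^j|^2$ and $\Delta$ the Laplace-Beltrami operator, $$-\Delta\phi^i=|d\phi|^2\phi^i+\operatorname{Re}\langle\psi^i,e_\alpha\cdot\psi^j\rangle\,\phi^j_\alpha,\qquad \slashed\partial\psi^i=-\phi^i\,\phi^j_\alpha\, e_\alpha\cdot\psi^j-2\kappa\big(|\psi|^2\psi^i-\langle\psi^j,\psi^i\rangle\psi^j\big).$$ Define the Noether current, for $\alpha\in\{x,y\}$, by $$J_\alpha^{im}=\operatorname{Re}\langle\partial_\alpha\cdot\psi^i,\psi^m\rangle+(\partial_\alpha\phi^i)\,\phi^m-\phi^i\,\partial_\alpha\phi^m .$$ Then on $\Omega$, for all $i,m\in\{1,\dots,n+1\}$, $$\begin{aligned} \partial_xJ_y^{im}&-\partial_yJ_x^{im}-2\big(J_x^{ij}J_y^{jm}-J_y^{ij}J_x^{jm}\big) =-\partial_x\operatorname{Re}\langle\partial_y\cdot\psi^i,\psi^m\rangle+\partial_y\operatorname{Re}\langle\partial_x\cdot\psi^i,\psi^m\rangle\\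 &-2\big(\operatorname{Re}\langle\psi^i,\partial_x\cdot\psi^j\rangle\operatorname{Re}\langle\psi^j,\partial_y\cdot\psi^m\rangle-\operatorname{Re}\langle\psi^i,\partial_y\cdot\psi^j\rangle\operatorname{Re}\langle\psi^j,\partial_x\cdot\psi^m\rangle\big)\\ &+4\kappa\operatorname{Re}\big(2|\psi|^2\langle\psi^i,\partial_x\cdot\partial_y\cdot\psi^m\rangle+\langle\psi^i,\psi^j\rangle\langle\partial_x\cdot\partial_y\cdot\psi^j,\psi^m\rangle-\langle\psi^i,\partial_x\cdot\partial_y\cdot\psi^j\rangle\langle\psi^j,\psi^m\rangle\big). \end{aligned}$$ -/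

import Mathlib

open scoped ContDiff

noncomputable section

namespace DiracHarmonic

/-- The coordinate plane; the coordinates are `x = x⁰` and `y = x¹`. -/
abbrev Plane : Type := EuclideanSpace ℝ (Fin 2)

/-- The fibre of the spinor bundle of a surface in a spin frame, with its standard Hermitian product
`inner ℂ`, which is conjugate-linear in the first and linear in the second argument. -/
abbrev Spinor : Type := EuclideanSpace ℂ (Fin 2)

/-- The partial derivative `∂_α f`. -/
def pd {E : Type*} [NormedAddCommGroup E] [NormedSpace ℝ E]
    (α : Fin 2) (f : Plane → E) (p : Plane) : E :=
  fderiv ℝ f p (EuclideanSpace.single α 1)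

/-- Clifford multiplication by an orthonormal frame `e₀, e₁`: skew-Hermitian endomorphisms of the
spinor space that satisfy the Clifford relations `e_α e_β + e_β e_α = -2 δ_{αβ}`. -/
structure CliffordMul where
  e : Fin 2 → Spinor →ₗ[ℂ] Spinor
  skew : ∀ (α : Fin 2) (ψ η : Spinor), inner ℂ ψ (e α η) = -inner ℂ (e α ψ) η
  relation : ∀ (α β : Fin 2) (ψ : Spinor),
    e α (e β ψ) + e β (e α ψ) = if α = β then (-2 : ℂ) • ψ else 0

/- Throughout, `u` is the logarithm of the conformal factor: in the isothermal coordinates `x, y` the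
metric is `h = exp (2 u) (dx² + dy²)`, and `e_α = exp (-u) ∂_α` is an orthonormal frame. -/

/-- Clifford multiplication `∂_α · η` by the coordinate vector field `∂_α = exp u • e_α`. -/
def coordMul (γ : CliffordMul) (u : Plane → ℝ) (α : Fin 2) (p : Plane) (η : Spinor) : Spinor :=
  Real.exp (u p) • γ.e α η

/-- The Levi-Civita connection form `h(∇_{∂_α} e₀, e₁)` of `h` in the frame `e_α`: it equals
`-∂_y u` for `∂_x` and `∂_x u` for `∂_y`. -/
def connForm (u : Plane → ℝ) (α : Fin 2) (p : Plane) : ℝ :=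
  if α = 0 then -pd 1 u p else pd 0 u p

/-- The spinor connection
`∇_{∂_α} ψ = ∂_α ψ + ½ h(∇_{∂_α} e₀, e₁) e₀ · e₁ · ψ` in the spin frame over `e_α`. -/
def spinConn (γ : CliffordMul) (u : Plane → ℝ) (α : Fin 2) (ψ : Plane → Spinor) (p : Plane) :
    Spinor :=
  pd α ψ p + (1 / 2 * connForm u α p) • γ.e 0 (γ.e 1 (ψ p))

/-- The Dirac operator `e_α · ∇_{e_α} ψ`. -/
def dirac (γ : CliffordMul) (u : Plane → ℝ) (ψ : Plane → Spinor) (p : Plane) : Spinor :=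
  ∑ α, γ.e α (Real.exp (-u p) • spinConn γ u α ψ p)

/-- The Laplace-Beltrami operator of `h`. -/
def laplace (u : Plane → ℝ) (f : Plane → ℝ) (p : Plane) : ℝ :=
  Real.exp (-2 * u p) * ∑ α, pd α (pd α f) p

/-- The derivative `df(e_α)` in the direction of the orthonormal frame. -/
def frameDeriv (u : Plane → ℝ) (α : Fin 2) (f : Plane → ℝ) (p : Plane) : ℝ :=
  Real.exp (-u p) * pd α f p

variable {n : ℕ}

/-- The squared norm `|ψ|²` of a vector spinor. -/
def normSqSpinor (ψ : Fin (n + 1) → Plane → Spinor) (p : Plane) : ℝ :=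
  ∑ j, ‖ψ j p‖ ^ 2

/-- `(φ, ψ)` is a smooth `κ`-Dirac-harmonic map from the coordinate domain `Ω`, with the metric
`exp (2 u) (dx² + dy²)`, to the round sphere `Sⁿ ⊂ ℝⁿ⁺¹`. The vector spinor `ψ` along `φ` is given by
its components `ψⁱ`, and `∑ φⁱ ψⁱ = 0` says that it takes values in the tangent spaces of `Sⁿ`. -/
structure IsKappaDiracHarmonic (γ : CliffordMul) (Ω : Set Plane) (u : Plane → ℝ) (κ : ℝ)
    (φ : Plane → EuclideanSpace ℝ (Fin (n + 1))) (ψ : Fin (n + 1) → Plane → Spinor) : Prop where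
  smooth_map : ContDiffOn ℝ ∞ φ Ω
  smooth_spinor : ∀ i, ContDiffOn ℝ ∞ (ψ i) Ω
  mem_sphere : ∀ p ∈ Ω, φ p ∈ Metric.sphere (0 : EuclideanSpace ℝ (Fin (n + 1))) 1
  tangent : ∀ p ∈ Ω, ∑ i, φ p i • ψ i p = 0
  map_eq : ∀ p ∈ Ω, ∀ i,
    -laplace u (fun q => φ q i) p =
      (∑ α, ∑ j, frameDeriv u α (fun q => φ q j) p ^ 2) * φ p i
        + ∑ α, ∑ j, (inner ℂ (ψ i p) (γ.e α (ψ j p))).re * frameDeriv u α (fun q => φ q j) p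
  spinor_eq : ∀ p ∈ Ω, ∀ i,
    dirac γ u (ψ i) p =
      -(φ p i • ∑ α, ∑ j, frameDeriv u α (fun q => φ q j) p • γ.e α (ψ j p))
        - (2 * κ) • (normSqSpinor ψ p • ψ i p - ∑ j, inner ℂ (ψ j p) (ψ i p) • ψ j p)

/-- The Noether current
`J_α^{im} = Re ⟨∂_α · ψⁱ, ψᵐ⟩ + (∂_α φⁱ φᵐ - φⁱ ∂_α φᵐ)` in the direction `∂_α`. -/
def current (γ : CliffordMul) (u : Plane → ℝ)
    (φ : Plane → EuclideanSpace ℝ (Fin (n + 1))) (ψ : Fin (n + 1) → Plane → Spinor)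
    (α : Fin 2) (i m : Fin (n + 1)) (p : Plane) : ℝ :=
  (inner ℂ (coordMul γ u α p (ψ i p)) (ψ m p)).re
    + (pd α (fun q => φ q i) p * φ p m - φ p i * pd α (fun q => φ q m) p)

end DiracHarmonic

end

/-! The Noether current is `J_α = S_α + ∂_α φ ∧ φ`, where `S_α` is skew-symmetric and, since `ψ` is
tangent to the sphere, `S_α φ = 0`. As `|φ| = 1`, expanding the commutator gives
`[J_x, J_y] = [S_x, S_y] + v ∧ φ - ∂_x φ ∧ ∂_y φ` with `v = S_x ∂_y φ - S_y ∂_x φ`, and the last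
term is half the curl of `∂_α φ ∧ φ`. Hence the asserted identity amounts to
`curl S = v ∧ φ + 2 κ Q` with `Q` quartic in `ψ`.

Multiplying the Dirac operator by `∂_x · ∂_y ·` turns it into `∂_y · ∇_x - ∂_x · ∇_y`. Hence
`curl Re ⟨∂ · ψ, η⟩ = Re ⟨∂_x · ∂_y · ∂̸ ψ, η⟩ - Re ⟨∂_x · ∂_y · ∂̸ η, ψ⟩`, as the connection terms
account exactly for the derivative of the conformal factor. Inserting the equation for `∂̸ ψ` yields
`curl S`. -/

namespace DiracHarmonic

open scoped Matrix Topology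

section WedgeMatrix

variable {ι R : Type*} [CommRing R]

/-- The matrix `a bᵀ - b aᵀ` of the bivector `a ∧ b`. -/
def wedgeMatrix (a b : ι → R) : Matrix ι ι R :=
  Matrix.vecMulVec a b - Matrix.vecMulVec b a

theorem wedgeMatrix_apply (a b : ι → R) (i j : ι) :
    wedgeMatrix a b i j = a i * b j - b i * a j := rfl

theorem wedgeMatrix_swap (a b : ι → R) : wedgeMatrix b a = -wedgeMatrix a b :=
  (neg_sub _ _).symm

theorem wedgeMatrix_transpose (a b : ι → R) : (wedgeMatrix a b)ᵀ = -wedgeMatrix a b := by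
  rw [← wedgeMatrix_swap, wedgeMatrix, wedgeMatrix, Matrix.transpose_sub,
    Matrix.transpose_vecMulVec, Matrix.transpose_vecMulVec]

theorem wedgeMatrix_sub_left (a b c : ι → R) :
    wedgeMatrix (a - b) c = wedgeMatrix a c - wedgeMatrix b c := by
  ext i j
  simp only [wedgeMatrix_apply, Matrix.sub_apply, Pi.sub_apply]
  ring

variable [Fintype ι]

theorem wedgeMatrix_mulVec (a b v : ι → R) :
    wedgeMatrix a b *ᵥ v = (b ⬝ᵥ v) • a - (a ⬝ᵥ v) • b := by
  simp only [wedgeMatrix, Matrix.sub_mulVec, Matrix.vecMulVec_mulVec, op_smul_eq_smul]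

theorem commutator_wedgeMatrix {S : Matrix ι ι R} (hS : Sᵀ = -S) (a b : ι → R) :
    S * wedgeMatrix a b - wedgeMatrix a b * S =
      wedgeMatrix (S *ᵥ a) b + wedgeMatrix a (S *ᵥ b) := by
  have hvec (v : ι → R) : v ᵥ* S = -(S *ᵥ v) := by
    rw [← Matrix.mulVec_transpose, hS, Matrix.neg_mulVec]
  simp only [wedgeMatrix, mul_sub, sub_mul, Matrix.mul_vecMulVec, Matrix.vecMulVec_mul, hvec,
    Matrix.vecMulVec_neg]
  abel

theorem commutator_add_wedgeMatrix {S T : Matrix ι ι R} {a b c : ι → R}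
    (hS : Sᵀ = -S) (hT : Tᵀ = -T) (hSa : S *ᵥ a = 0) (hTa : T *ᵥ a = 0)
    (haa : a ⬝ᵥ a = 1) (hab : a ⬝ᵥ b = 0) (hac : a ⬝ᵥ c = 0) :
    (S + wedgeMatrix b a) * (T + wedgeMatrix c a) -
        (T + wedgeMatrix c a) * (S + wedgeMatrix b a) =
      S * T - T * S + wedgeMatrix (S *ᵥ c - T *ᵥ b) a - wedgeMatrix b c := by
  have hSc : S * wedgeMatrix c a - wedgeMatrix c a * S = wedgeMatrix (S *ᵥ c) a := by
    rw [commutator_wedgeMatrix hS, hSa]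
    simp [wedgeMatrix]
  have hTb : T * wedgeMatrix b a - wedgeMatrix b a * T = wedgeMatrix (T *ᵥ b) a := by
    rw [commutator_wedgeMatrix hT, hTa]
    simp [wedgeMatrix]
  have hbc : wedgeMatrix b a * wedgeMatrix c a - wedgeMatrix c a * wedgeMatrix b a =
      -wedgeMatrix b c := by
    rw [commutator_wedgeMatrix (wedgeMatrix_transpose b a), wedgeMatrix_mulVec,
      wedgeMatrix_mulVec, hac, haa, dotProduct_comm b a, hab, dotProduct_comm b c]
    ext i j
    simp only [wedgeMatrix_apply, Matrix.add_apply, Matrix.neg_apply, Pi.sub_apply, Pi.smul_apply,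
      smul_eq_mul]
    ring
  rw [wedgeMatrix_sub_left, ← hSc, ← hTb, sub_eq_add_neg _ (wedgeMatrix b c), ← hbc]
  noncomm_ring

end WedgeMatrix

section Calculus

variable {p : Plane}

section NormedSpace

variable {E : Type*} [NormedAddCommGroup E] [NormedSpace ℝ E] {f : Plane → E}

theorem differentiableAt_pd (hf : ContDiffAt ℝ 2 f p) (α : Fin 2) :
    DifferentiableAt ℝ (pd α f) p :=
  ((hf.fderiv_right (m := 1) le_rfl).differentiableAt one_ne_zero).clm_apply
    (differentiableAt_const _)

theorem pd_comm (hf : ContDiffAt ℝ 2 f p) (α β : Fin 2) :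
    pd α (pd β f) p = pd β (pd α f) p := by
  have hf' : DifferentiableAt ℝ (fderiv ℝ f) p :=
    (hf.fderiv_right (m := 1) le_rfl).differentiableAt one_ne_zero
  have pd_pd (α β : Fin 2) : pd α (pd β f) p =
      fderiv ℝ (fderiv ℝ f) p (EuclideanSpace.single α 1) (EuclideanSpace.single β 1) := by
    change fderiv ℝ (fun q => fderiv ℝ f q (EuclideanSpace.single β 1)) p _ = _
    rw [fderiv_clm_apply hf' (differentiableAt_const _)]
    simp
  rw [pd_pd, pd_pd, (hf.isSymmSndFDerivAt (by simp)).eq]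

end NormedSpace

theorem pd_mul {A : Type*} [NormedRing A] [NormedAlgebra ℝ A] {f g : Plane → A}
    (hf : DifferentiableAt ℝ f p) (hg : DifferentiableAt ℝ g p) (α : Fin 2) :
    pd α (fun q => f q * g q) p = pd α f p * g p + f p * pd α g p := by
  simp only [pd, fderiv_fun_mul' hf hg, add_apply, smul_apply, smul_eq_mul,
    MulOpposite.smul_eq_mul_unop, MulOpposite.unop_op]
  exact add_comm _ _

theorem pd_euclidean_apply {ι : Type*} [Fintype ι] {φ : Plane → EuclideanSpace ℝ ι}
    (hφ : DifferentiableAt ℝ φ p) (α : Fin 2) (i : ι) :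
    pd α (fun q => φ q i) p = pd α φ p i :=
  congrArg (fun L : Plane →L[ℝ] ℝ => L (EuclideanSpace.single α 1))
    ((EuclideanSpace.proj (𝕜 := ℝ) i).hasFDerivAt.comp p hφ.hasFDerivAt).fderiv

theorem inner_pd_eq_zero_of_norm_eq {E : Type*} [NormedAddCommGroup E] [InnerProductSpace ℝ E]
    {f : Plane → E} {r : ℝ} (hf : DifferentiableAt ℝ f p) (hr : ∀ᶠ q in 𝓝 p, ‖f q‖ = r)
    (α : Fin 2) : inner ℝ (f p) (pd α f p) = 0 := by
  have hconst : (fun q => ‖f q‖ ^ 2) =ᶠ[𝓝 p] fun _ => r ^ 2 := hr.mono fun q hq => by simp [hq]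
  have hzero := (hf.hasFDerivAt.norm_sq.congr_of_eventuallyEq hconst.symm).unique
    (hasFDerivAt_const (r ^ 2) p)
  simpa [pd] using congrArg (fun L : Plane →L[ℝ] ℝ => L (EuclideanSpace.single α 1)) hzero

theorem pd_re_inner {E : Type*} [NormedAddCommGroup E] [InnerProductSpace ℂ E] {f g : Plane → E}
    (hf : DifferentiableAt ℝ f p) (hg : DifferentiableAt ℝ g p) (α : Fin 2) :
    pd α (fun q => (inner ℂ (f q) (g q)).re) p =
      (inner ℂ (pd α f p) (g p)).re + (inner ℂ (f p) (pd α g p)).re := by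
  have h : HasFDerivAt (fun q => (inner ℂ (f q) (g q)).re) _ p :=
    Complex.reCLM.hasFDerivAt.comp p (hf.hasFDerivAt.inner ℂ hg.hasFDerivAt)
  rw [pd, h.fderiv]
  simp [pd, fderivInnerCLM_apply, add_comm]

end Calculus

section Curl

variable {E : Type*} [NormedAddCommGroup E] [NormedSpace ℝ E]

/-- The curl `∂_x A_y - ∂_y A_x`, i.e. the coefficient of `dx ∧ dy` in the exterior derivative of
the one-form `A_x dx + A_y dy`. -/
noncomputable def curl (A : Fin 2 → Plane → E) (p : Plane) : E :=
  pd 0 (A 1) p - pd 1 (A 0) p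

theorem curl_add {A B : Fin 2 → Plane → E} {p : Plane} (hA : ∀ α, DifferentiableAt ℝ (A α) p)
    (hB : ∀ α, DifferentiableAt ℝ (B α) p) :
    curl (fun α q => A α q + B α q) p = curl A p + curl B p := by
  simp only [curl, pd, fderiv_fun_add (hA _) (hB _), add_apply]
  abel

theorem curl_pd_mul_sub_mul_pd {A : Type*} [NormedCommRing A] [NormedAlgebra ℝ A]
    {f g : Plane → A} {p : Plane} (hf : ContDiffAt ℝ 2 f p) (hg : ContDiffAt ℝ 2 g p) :
    curl (fun α q => pd α f q * g q - f q * pd α g q) p =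
      -2 * (pd 0 f p * pd 1 g p - pd 1 f p * pd 0 g p) := by
  have hf₁ := hf.differentiableAt two_ne_zero
  have hg₁ := hg.differentiableAt two_ne_zero
  have hpd (α β : Fin 2) : pd β (fun q => pd α f q * g q - f q * pd α g q) p =
      pd β (pd α f) p * g p + pd α f p * pd β g p
        - (pd β f p * pd α g p + f p * pd β (pd α g) p) := by
    rw [← pd_mul (differentiableAt_pd hf α) hg₁, ← pd_mul hf₁ (differentiableAt_pd hg α), pd,
      fderiv_fun_sub ((differentiableAt_pd hf α).fun_mul hg₁)
        (hf₁.fun_mul (differentiableAt_pd hg α))]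
    rfl
  rw [curl, hpd, hpd, pd_comm hf 0 1, pd_comm hg 0 1]
  ring

end Curl

namespace CliffordMul

variable (γ : CliffordMul)

theorem e_e_self (α : Fin 2) (a : Spinor) : γ.e α (γ.e α a) = -a := by
  have h := γ.relation α α a
  rw [if_pos rfl, ← two_smul ℂ, neg_smul, ← smul_neg] at h
  exact smul_right_injective _ (two_ne_zero (α := ℂ)) h

theorem e_one_e_zero (a : Spinor) : γ.e 1 (γ.e 0 a) = -γ.e 0 (γ.e 1 a) :=
  eq_neg_of_add_eq_zero_left (γ.relation 1 0 a)

end CliffordMul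

section CoordMul

variable (γ : CliffordMul) (u : Plane → ℝ) (p : Plane)

/-- Clifford multiplication `∂_α ·` at the point `p` as a linear map. -/
noncomputable def coordMulₗ (α : Fin 2) : Spinor →ₗ[ℂ] Spinor :=
  Real.exp (u p) • γ.e α

/-- Clifford multiplication `∂_x · ∂_y ·` at the point `p` by the coordinate bivector. -/
noncomputable def areaMul : Spinor →ₗ[ℂ] Spinor :=
  coordMulₗ γ u p 0 ∘ₗ coordMulₗ γ u p 1

theorem inner_coordMul_right (α : Fin 2) (a b : Spinor) :
    inner ℂ a (coordMul γ u α p b) = -inner ℂ (coordMul γ u α p a) b := by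
  rw [coordMul, coordMul, inner_smul_right_eq_smul, inner_smul_left_eq_smul, γ.skew, smul_neg]

theorem re_inner_coordMul_swap (α : Fin 2) (a b : Spinor) :
    (inner ℂ (coordMul γ u α p a) b).re = -(inner ℂ (coordMul γ u α p b) a).re := by
  rw [← Complex.neg_re, ← inner_coordMul_right, ← inner_conj_symm, Complex.conj_re]

theorem coordMul_one_coordMul_zero (a : Spinor) :
    coordMul γ u 1 p (coordMul γ u 0 p a) = -areaMul γ u p a := by
  simp only [areaMul, coordMulₗ, coordMul, LinearMap.comp_apply, LinearMap.smul_apply,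
    LinearMap.map_smul_of_tower, γ.e_one_e_zero, smul_neg]

theorem inner_areaMul_right (a b : Spinor) :
    inner ℂ a (areaMul γ u p b) = -inner ℂ (areaMul γ u p a) b := by
  change inner ℂ a (coordMul γ u 0 p (coordMul γ u 1 p b)) = _
  rw [inner_coordMul_right, inner_coordMul_right, neg_neg, coordMul_one_coordMul_zero,
    inner_neg_left]

theorem exp_neg_smul_areaMul_e_zero (a : Spinor) :
    Real.exp (-u p) • areaMul γ u p (γ.e 0 a) = coordMul γ u 1 p a := by
  simp only [areaMul, coordMulₗ, coordMul, LinearMap.comp_apply, LinearMap.smul_apply,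
    LinearMap.map_smul_of_tower, γ.e_one_e_zero, γ.e_e_self, map_neg, neg_neg, Real.exp_neg]
  rw [inv_smul_smul₀ (Real.exp_ne_zero (u p))]

theorem exp_neg_smul_areaMul_e_one (a : Spinor) :
    Real.exp (-u p) • areaMul γ u p (γ.e 1 a) = -coordMul γ u 0 p a := by
  simp only [areaMul, coordMulₗ, coordMul, LinearMap.comp_apply, LinearMap.smul_apply,
    LinearMap.map_smul_of_tower, γ.e_e_self, map_neg, smul_neg, Real.exp_neg]
  rw [inv_smul_smul₀ (Real.exp_ne_zero (u p))]

theorem areaMul_dirac_eq_spinConn (ψ : Plane → Spinor) :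
    areaMul γ u p (dirac γ u ψ p) =
      coordMul γ u 1 p (spinConn γ u 0 ψ p) - coordMul γ u 0 p (spinConn γ u 1 ψ p) := by
  simp only [dirac, Fin.sum_univ_two, map_add, LinearMap.map_smul_of_tower,
    exp_neg_smul_areaMul_e_zero, exp_neg_smul_areaMul_e_one, sub_eq_add_neg]

theorem areaMul_dirac (ψ : Plane → Spinor) :
    areaMul γ u p (dirac γ u ψ p) =
      coordMul γ u 1 p (pd 0 ψ p) - coordMul γ u 0 p (pd 1 ψ p)
        + (1 / 2 : ℝ) •
          (pd 0 u p • coordMul γ u 1 p (ψ p) - pd 1 u p • coordMul γ u 0 p (ψ p)) := by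
  rw [areaMul_dirac_eq_spinConn]
  simp only [coordMul, spinConn, connForm, map_add, LinearMap.map_smul_of_tower, γ.e_e_self,
    γ.e_one_e_zero, map_neg, if_true, one_ne_zero, if_false]
  module

variable {γ u p} {ψ η : Plane → Spinor}

theorem hasFDerivAt_coordMul (hu : DifferentiableAt ℝ u p) (hψ : DifferentiableAt ℝ ψ p)
    (α : Fin 2) :
    HasFDerivAt (fun q => coordMul γ u α q (ψ q))
      (Real.exp (u p) • ((γ.e α).toContinuousLinearMap.restrictScalars ℝ).comp (fderiv ℝ ψ p)
        + (Real.exp (u p) • fderiv ℝ u p).smulRight (γ.e α (ψ p))) p :=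
  hu.hasFDerivAt.exp.smul
    (((γ.e α).toContinuousLinearMap.restrictScalars ℝ).hasFDerivAt.comp p hψ.hasFDerivAt)

theorem pd_coordMul (hu : DifferentiableAt ℝ u p) (hψ : DifferentiableAt ℝ ψ p) (α β : Fin 2) :
    pd β (fun q => coordMul γ u α q (ψ q)) p =
      coordMul γ u α p (pd β ψ p) + pd β u p • coordMul γ u α p (ψ p) := by
  rw [pd, (hasFDerivAt_coordMul hu hψ α).fderiv]
  simp only [pd, add_apply, smul_apply, ContinuousLinearMap.smulRight_apply]
  simpa [coordMul, mul_smul] using smul_comm _ _ _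

theorem differentiableAt_re_inner_coordMul (hu : DifferentiableAt ℝ u p)
    (hψ : DifferentiableAt ℝ ψ p) (hη : DifferentiableAt ℝ η p) (α : Fin 2) :
    DifferentiableAt ℝ (fun q => (inner ℂ (coordMul γ u α q (ψ q)) (η q)).re) p :=
  Complex.reCLM.differentiableAt.comp p
    ((hasFDerivAt_coordMul hu hψ α).differentiableAt.inner ℂ hη)

theorem curl_re_inner_coordMul (hu : DifferentiableAt ℝ u p)
    (hψ : DifferentiableAt ℝ ψ p) (hη : DifferentiableAt ℝ η p) :
    curl (fun α q => (inner ℂ (coordMul γ u α q (ψ q)) (η q)).re) p =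
      (inner ℂ (areaMul γ u p (dirac γ u ψ p)) (η p)).re
        - (inner ℂ (areaMul γ u p (dirac γ u η p)) (ψ p)).re := by
  have hpd (α β : Fin 2) : pd β (fun q => (inner ℂ (coordMul γ u α q (ψ q)) (η q)).re) p =
      (inner ℂ (coordMul γ u α p (pd β ψ p)) (η p)).re
        + pd β u p * (inner ℂ (coordMul γ u α p (ψ p)) (η p)).re
        - (inner ℂ (coordMul γ u α p (pd β η p)) (ψ p)).re := by
    rw [pd_re_inner (hasFDerivAt_coordMul hu hψ α).differentiableAt hη, pd_coordMul hu hψ,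
      re_inner_coordMul_swap γ u p α (ψ p) (pd β η p), inner_add_left, inner_smul_left_eq_smul,
      Complex.add_re, Complex.smul_re, smul_eq_mul, sub_eq_add_neg]
  rw [curl, hpd, hpd, areaMul_dirac, areaMul_dirac]
  simp only [inner_add_left, inner_sub_left, inner_smul_left_eq_smul, Complex.add_re,
    Complex.sub_re, Complex.smul_re, smul_eq_mul]
  rw [re_inner_coordMul_swap γ u p 0 (η p), re_inner_coordMul_swap γ u p 1 (η p)]
  ring

end CoordMul

section SpinorCurrent

variable {ι : Type*} {γ : CliffordMul} {u : Plane → ℝ} {p : Plane} {ψ : ι → Plane → Spinor}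

/-- The spinorial part `Re ⟨∂_α · ψⁱ, ψᵐ⟩` of the Noether current, as a matrix in `i` and `m`. -/
noncomputable def spinorCurrent (γ : CliffordMul) (u : Plane → ℝ) (ψ : ι → Plane → Spinor)
    (α : Fin 2) (p : Plane) : Matrix ι ι ℝ :=
  Matrix.of fun i m => (inner ℂ (coordMul γ u α p (ψ i p)) (ψ m p)).re

theorem spinorCurrent_apply_swap (α : Fin 2) (i m : ι) :
    spinorCurrent γ u ψ α p i m = -spinorCurrent γ u ψ α p m i :=
  re_inner_coordMul_swap γ u p α (ψ i p) (ψ m p)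

theorem spinorCurrent_transpose (α : Fin 2) :
    (spinorCurrent γ u ψ α p)ᵀ = -spinorCurrent γ u ψ α p :=
  Matrix.ext fun i m => spinorCurrent_apply_swap α m i

theorem re_inner_coordMul_right_eq_neg_spinorCurrent (α : Fin 2) (i m : ι) :
    (inner ℂ (ψ i p) (coordMul γ u α p (ψ m p))).re = -spinorCurrent γ u ψ α p i m :=
  congrArg Complex.re (inner_coordMul_right γ u p α (ψ i p) (ψ m p))

theorem spinorCurrent_mulVec_eq_zero [Fintype ι] {a : ι → ℝ} (ha : ∑ j, a j • ψ j p = 0)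
    (α : Fin 2) : spinorCurrent γ u ψ α p *ᵥ a = 0 := by
  ext i
  have h := congrArg (fun b => (inner ℂ (coordMul γ u α p (ψ i p)) b).re) ha
  simp only [inner_sum, inner_smul_right_eq_smul, Complex.re_sum, Complex.smul_re, smul_eq_mul,
    inner_zero_right, Complex.zero_re] at h
  simpa only [Matrix.mulVec, dotProduct, spinorCurrent, Matrix.of_apply, mul_comm,
    Pi.zero_apply] using h

/-- The vector `S_x ∂_y φ - S_y ∂_x φ`, where `S_α` is the spinorial part of the Noether current. -/
noncomputable def currentTwist [Fintype ι] (γ : CliffordMul) (u : Plane → ℝ)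
    (φ : Plane → EuclideanSpace ℝ ι) (ψ : ι → Plane → Spinor) (p : Plane) : ι → ℝ :=
  spinorCurrent γ u ψ 0 p *ᵥ ⇑(pd 1 φ p) - spinorCurrent γ u ψ 1 p *ᵥ ⇑(pd 0 φ p)

end SpinorCurrent

section SpinorEquation

variable {n : ℕ} {γ : CliffordMul} {u : Plane → ℝ} {κ : ℝ} {p : Plane}
  {φ : Plane → EuclideanSpace ℝ (Fin (n + 1))} {ψ : Fin (n + 1) → Plane → Spinor}

/-- The equation for `∂̸ ψ` satisfied at `p` by a `κ`-Dirac-harmonic map into a sphere. -/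
def SpinorEquationAt (γ : CliffordMul) (u : Plane → ℝ) (κ : ℝ)
    (φ : Plane → EuclideanSpace ℝ (Fin (n + 1))) (ψ : Fin (n + 1) → Plane → Spinor)
    (p : Plane) : Prop :=
  ∀ i, dirac γ u (ψ i) p =
    -(φ p i • ∑ α, ∑ j, frameDeriv u α (fun q => φ q j) p • γ.e α (ψ j p))
      - (2 * κ) • (normSqSpinor ψ p • ψ i p - ∑ j, inner ℂ (ψ j p) (ψ i p) • ψ j p)

/-- The quartic spinor term that `κ` contributes to the curl of the Noether current. -/
noncomputable def quarticTerm (γ : CliffordMul) (u : Plane → ℝ) (ψ : Fin (n + 1) → Plane → Spinor)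
    (p : Plane) (i m : Fin (n + 1)) : ℝ :=
  (2 * (normSqSpinor ψ p : ℂ) * inner ℂ (ψ i p) (areaMul γ u p (ψ m p))
    + ∑ j, (inner ℂ (ψ i p) (ψ j p) * inner ℂ (areaMul γ u p (ψ j p)) (ψ m p)
      - inner ℂ (ψ i p) (areaMul γ u p (ψ j p)) * inner ℂ (ψ j p) (ψ m p))).re

theorem SpinorEquationAt.areaMul_dirac (h : SpinorEquationAt γ u κ φ ψ p)
    (hφ : DifferentiableAt ℝ φ p) (i : Fin (n + 1)) :
    areaMul γ u p (dirac γ u (ψ i) p) =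
      -(φ p i • ∑ j, (pd 0 φ p j • coordMul γ u 1 p (ψ j p)
          - pd 1 φ p j • coordMul γ u 0 p (ψ j p)))
        - (2 * κ) • (normSqSpinor ψ p • areaMul γ u p (ψ i p)
          - ∑ j, inner ℂ (ψ j p) (ψ i p) • areaMul γ u p (ψ j p)) := by
  have hcomm (α : Fin 2) (j : Fin (n + 1)) :
      frameDeriv u α (fun q => φ q j) p • γ.e α (ψ j p) =
        pd α φ p j • Real.exp (-u p) • γ.e α (ψ j p) := by
    rw [frameDeriv, pd_euclidean_apply hφ, mul_comm, mul_smul]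
  rw [h i]
  simp only [hcomm, Fin.sum_univ_two, map_sub, map_neg, map_add, map_sum, map_smul,
    LinearMap.map_smul_of_tower, exp_neg_smul_areaMul_e_zero,
    exp_neg_smul_areaMul_e_one, smul_neg, Finset.sum_neg_distrib, Finset.sum_sub_distrib,
    ← sub_eq_add_neg]

theorem SpinorEquationAt.re_inner_areaMul_dirac (h : SpinorEquationAt γ u κ φ ψ p)
    (hφ : DifferentiableAt ℝ φ p) (i m : Fin (n + 1)) :
    (inner ℂ (areaMul γ u p (dirac γ u (ψ i) p)) (ψ m p)).re =
      -(φ p i * currentTwist γ u φ ψ p m)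
        - 2 * κ * (normSqSpinor ψ p * (inner ℂ (areaMul γ u p (ψ i p)) (ψ m p)).re
          - ∑ j, (inner ℂ (ψ i p) (ψ j p) * inner ℂ (areaMul γ u p (ψ j p)) (ψ m p)).re) := by
  have htwist : currentTwist γ u φ ψ p m =
      ∑ j, (pd 0 φ p j * (inner ℂ (coordMul γ u 1 p (ψ j p)) (ψ m p)).re
        - pd 1 φ p j * (inner ℂ (coordMul γ u 0 p (ψ j p)) (ψ m p)).re) := by
    simp only [currentTwist, Pi.sub_apply, Matrix.mulVec, dotProduct, ← Finset.sum_sub_distrib]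
    refine Finset.sum_congr rfl fun j _ => ?_
    rw [spinorCurrent_apply_swap 0 m j, spinorCurrent_apply_swap 1 m j]
    simp only [spinorCurrent, Matrix.of_apply]
    ring
  rw [h.areaMul_dirac hφ, htwist]
  simp only [inner_sub_left, inner_neg_left, inner_smul_left_eq_smul, inner_smul_left, sum_inner,
    inner_conj_symm, Complex.sub_re, Complex.neg_re, Complex.smul_re, smul_eq_mul, Complex.re_sum]

theorem quarticTerm_eq (i m : Fin (n + 1)) :
    quarticTerm γ u ψ p i m =
      -2 * normSqSpinor ψ p * (inner ℂ (areaMul γ u p (ψ i p)) (ψ m p)).re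
        + ∑ j, (inner ℂ (ψ i p) (ψ j p) * inner ℂ (areaMul γ u p (ψ j p)) (ψ m p)).re
        - ∑ j, (inner ℂ (ψ m p) (ψ j p) * inner ℂ (areaMul γ u p (ψ j p)) (ψ i p)).re := by
  have hconj (j : Fin (n + 1)) :
      (inner ℂ (ψ m p) (ψ j p) * inner ℂ (areaMul γ u p (ψ j p)) (ψ i p)).re =
        (inner ℂ (ψ i p) (areaMul γ u p (ψ j p)) * inner ℂ (ψ j p) (ψ m p)).re := by
    rw [← Complex.conj_re, map_mul, inner_conj_symm, inner_conj_symm, mul_comm]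
  have hnorm : (2 * (normSqSpinor ψ p : ℂ) * inner ℂ (ψ i p) (areaMul γ u p (ψ m p))).re =
      -2 * normSqSpinor ψ p * (inner ℂ (areaMul γ u p (ψ i p)) (ψ m p)).re := by
    rw [inner_areaMul_right, ← Complex.ofReal_ofNat, ← Complex.ofReal_mul, Complex.re_ofReal_mul,
      Complex.neg_re]
    ring
  simp only [quarticTerm, Complex.add_re, Complex.re_sum, Complex.sub_re,
    Finset.sum_sub_distrib, hconj, hnorm]
  ring

theorem SpinorEquationAt.curl_spinorCurrent (h : SpinorEquationAt γ u κ φ ψ p)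
    (hu : DifferentiableAt ℝ u p) (hφ : DifferentiableAt ℝ φ p)
    (hψ : ∀ j, DifferentiableAt ℝ (ψ j) p) (i m : Fin (n + 1)) :
    curl (fun α q => spinorCurrent γ u ψ α q i m) p =
      wedgeMatrix (currentTwist γ u φ ψ p) (φ p) i m + 2 * κ * quarticTerm γ u ψ p i m := by
  have hskew : (inner ℂ (areaMul γ u p (ψ m p)) (ψ i p)).re =
      -(inner ℂ (areaMul γ u p (ψ i p)) (ψ m p)).re := by
    rw [← Complex.neg_re, ← inner_areaMul_right, ← inner_conj_symm, Complex.conj_re]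
  refine (curl_re_inner_coordMul hu (hψ i) (hψ m)).trans ?_
  rw [h.re_inner_areaMul_dirac hφ, h.re_inner_areaMul_dirac hφ, hskew, quarticTerm_eq,
    wedgeMatrix_apply]
  ring

end SpinorEquation

section NoetherCurrent

variable {n : ℕ} {γ : CliffordMul} {u : Plane → ℝ} {p : Plane}
  {φ : Plane → EuclideanSpace ℝ (Fin (n + 1))} {ψ : Fin (n + 1) → Plane → Spinor}

theorem current_eq_spinorCurrent_add_wedgeMatrix (hφ : DifferentiableAt ℝ φ p) (α : Fin 2)
    (i m : Fin (n + 1)) :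
    current γ u φ ψ α i m p = (spinorCurrent γ u ψ α p + wedgeMatrix ⇑(pd α φ p) (φ p)) i m := by
  rw [current, pd_euclidean_apply hφ, pd_euclidean_apply hφ]
  rfl

theorem curl_current (hu : DifferentiableAt ℝ u p) (hφ : ContDiffAt ℝ 2 φ p)
    (hψ : ∀ j, DifferentiableAt ℝ (ψ j) p) (i m : Fin (n + 1)) :
    curl (fun α => current γ u φ ψ α i m) p =
      curl (fun α q => spinorCurrent γ u ψ α q i m) p
        - 2 * wedgeMatrix ⇑(pd 0 φ p) ⇑(pd 1 φ p) i m := by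
  have hφc := contDiffAt_euclidean.1 hφ
  have hφd := hφ.differentiableAt two_ne_zero
  have hcoord (j) : DifferentiableAt ℝ (fun q => φ q j) p :=
    (hφc j).differentiableAt two_ne_zero
  refine (curl_add (differentiableAt_re_inner_coordMul hu (hψ i) (hψ m)) fun α =>
    ((differentiableAt_pd (hφc i) α).fun_mul (hcoord m)).fun_sub
      ((hcoord i).fun_mul (differentiableAt_pd (hφc m) α))).trans ?_
  rw [curl_pd_mul_sub_mul_pd (hφc i) (hφc m)]
  simp only [pd_euclidean_apply hφd, wedgeMatrix_apply, neg_mul, ← sub_eq_add_neg]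
  rfl

theorem sum_current_commutator (hφ : DifferentiableAt ℝ φ p) (hnorm : ∀ᶠ q in 𝓝 p, ‖φ q‖ = 1)
    (htangent : ∑ j, φ p j • ψ j p = 0) (i m : Fin (n + 1)) :
    ∑ j, (current γ u φ ψ 0 i j p * current γ u φ ψ 1 j m p
        - current γ u φ ψ 1 i j p * current γ u φ ψ 0 j m p) =
      ∑ j, (spinorCurrent γ u ψ 0 p i j * spinorCurrent γ u ψ 1 p j m
          - spinorCurrent γ u ψ 1 p i j * spinorCurrent γ u ψ 0 p j m)
        + wedgeMatrix (currentTwist γ u φ ψ p) (φ p) i m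
        - wedgeMatrix ⇑(pd 0 φ p) ⇑(pd 1 φ p) i m := by
  have hdot (v : EuclideanSpace ℝ (Fin (n + 1))) : φ p ⬝ᵥ ⇑v = inner ℝ (φ p) v := by
    simp [PiLp.inner_apply, dotProduct, mul_comm]
  have hunit : φ p ⬝ᵥ φ p = 1 := by
    rw [hdot, real_inner_self_eq_norm_sq, hnorm.self_of_nhds, one_pow]
  have horth (α : Fin 2) : φ p ⬝ᵥ ⇑(pd α φ p) = 0 :=
    (hdot _).trans (inner_pd_eq_zero_of_norm_eq hφ hnorm α)
  have hcomm := congrFun₂ (commutator_add_wedgeMatrix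
    (spinorCurrent_transpose (γ := γ) (u := u) 0) (spinorCurrent_transpose (γ := γ) (u := u) 1)
    (spinorCurrent_mulVec_eq_zero htangent 0) (spinorCurrent_mulVec_eq_zero htangent 1)
    hunit (horth 0) (horth 1)) i m
  simpa only [current_eq_spinorCurrent_add_wedgeMatrix hφ, currentTwist, Matrix.sub_apply,
    Matrix.add_apply, Matrix.mul_apply, Finset.sum_sub_distrib] using hcomm

end NoetherCurrent

end DiracHarmonic

open DiracHarmonic in
open scoped Topology in
theorem mainTheorem5_general {n : ℕ} {γ : CliffordMul} {u : Plane → ℝ} {κ : ℝ}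
    {φ : Plane → EuclideanSpace ℝ (Fin (n + 1))} {ψ : Fin (n + 1) → Plane → Spinor} {p : Plane}
    (hu : DifferentiableAt ℝ u p) (hφ : ContDiffAt ℝ 2 φ p)
    (hψ : ∀ j, DifferentiableAt ℝ (ψ j) p) (hnorm : ∀ᶠ q in 𝓝 p, ‖φ q‖ = 1)
    (htangent : ∑ j, φ p j • ψ j p = 0) (hdirac : SpinorEquationAt γ u κ φ ψ p)
    (i m : Fin (n + 1)) :
    pd 0 (current γ u φ ψ 1 i m) p - pd 1 (current γ u φ ψ 0 i m) p
        - 2 * ∑ j, (current γ u φ ψ 0 i j p * current γ u φ ψ 1 j m p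
            - current γ u φ ψ 1 i j p * current γ u φ ψ 0 j m p) =
      -pd 0 (fun q => (inner ℂ (coordMul γ u 1 q (ψ i q)) (ψ m q)).re) p
        + pd 1 (fun q => (inner ℂ (coordMul γ u 0 q (ψ i q)) (ψ m q)).re) p
        - 2 * ∑ j,
            ((inner ℂ (ψ i p) (coordMul γ u 0 p (ψ j p))).re
                * (inner ℂ (ψ j p) (coordMul γ u 1 p (ψ m p))).re
              - (inner ℂ (ψ i p) (coordMul γ u 1 p (ψ j p))).re
                * (inner ℂ (ψ j p) (coordMul γ u 0 p (ψ m p))).re)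
        + 4 * κ *
          (2 * (normSqSpinor ψ p : ℂ)
                * inner ℂ (ψ i p) (coordMul γ u 0 p (coordMul γ u 1 p (ψ m p)))
            + ∑ j, (inner ℂ (ψ i p) (ψ j p)
                  * inner ℂ (coordMul γ u 0 p (coordMul γ u 1 p (ψ j p))) (ψ m p)
                - inner ℂ (ψ i p) (coordMul γ u 0 p (coordMul γ u 1 p (ψ j p)))
                  * inner ℂ (ψ j p) (ψ m p))).re := by
  have hφ₁ := hφ.differentiableAt two_ne_zero
  have hJ := curl_current (γ := γ) hu hφ hψ i m
  have hcomm := sum_current_commutator (γ := γ) (u := u) hφ₁ hnorm htangent i m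
  have hS := hdirac.curl_spinorCurrent hu hφ₁ hψ i m
  simp only [re_inner_coordMul_right_eq_neg_spinorCurrent, neg_mul_neg]
  change curl (fun α => current γ u φ ψ α i m) p - _ =
    -pd 0 (fun q => spinorCurrent γ u ψ 1 q i m) p + pd 1 (fun q => spinorCurrent γ u ψ 0 q i m) p
      - _ + 4 * κ * quarticTerm γ u ψ p i m
  rw [hJ, hcomm]
  rw [curl] at hS ⊢
  linear_combination 2 * hS

open DiracHarmonic in
theorem mainTheorem5 {n : ℕ} (γ : CliffordMul) (Ω : Set Plane) (hΩ : IsOpen Ω)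
    (u : Plane → ℝ) (hu : ContDiffOn ℝ ∞ u Ω) (κ : ℝ)
    (φ : Plane → EuclideanSpace ℝ (Fin (n + 1))) (ψ : Fin (n + 1) → Plane → Spinor)
    (h : IsKappaDiracHarmonic γ Ω u κ φ ψ)
    (p : Plane) (hp : p ∈ Ω) (i m : Fin (n + 1)) :
    pd 0 (current γ u φ ψ 1 i m) p - pd 1 (current γ u φ ψ 0 i m) p
        - 2 * ∑ j, (current γ u φ ψ 0 i j p * current γ u φ ψ 1 j m p
            - current γ u φ ψ 1 i j p * current γ u φ ψ 0 j m p) =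
      -pd 0 (fun q => (inner ℂ (coordMul γ u 1 q (ψ i q)) (ψ m q)).re) p
        + pd 1 (fun q => (inner ℂ (coordMul γ u 0 q (ψ i q)) (ψ m q)).re) p
        - 2 * ∑ j,
            ((inner ℂ (ψ i p) (coordMul γ u 0 p (ψ j p))).re
                * (inner ℂ (ψ j p) (coordMul γ u 1 p (ψ m p))).re
              - (inner ℂ (ψ i p) (coordMul γ u 1 p (ψ j p))).re
                * (inner ℂ (ψ j p) (coordMul γ u 0 p (ψ m p))).re)
        + 4 * κ *
          (2 * (normSqSpinor ψ p : ℂ)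
                * inner ℂ (ψ i p) (coordMul γ u 0 p (coordMul γ u 1 p (ψ m p)))
            + ∑ j, (inner ℂ (ψ i p) (ψ j p)
                  * inner ℂ (coordMul γ u 0 p (coordMul γ u 1 p (ψ j p))) (ψ m p)
                - inner ℂ (ψ i p) (coordMul γ u 0 p (coordMul γ u 1 p (ψ j p)))
                  * inner ℂ (ψ j p) (ψ m p))).re := by
  have hmem := hΩ.mem_nhds hp
  exact mainTheorem5_general ((hu.contDiffAt hmem).differentiableAt (by simp))
    ((h.smooth_map.contDiffAt hmem).of_le (by norm_cast))
    (fun j => ((h.smooth_spinor j).contDiffAt hmem).differentiableAt (by simp))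
    (Filter.mem_of_superset hmem fun q hq => mem_sphere_zero_iff_norm.1 (h.mem_sphere q hq))
    (h.tangent p hp) (h.spinor_eq p hp) i m
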